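/- Let $\Omega\subset\mathbf R^3$ be a bounded open set. For $\varepsilon>0$ and $k\in\mathbf Z^3$ let $Y_\varepsilon^k=\varepsilon k+\varepsilon\left(-\tfrac12,\tfrac12\right)^3$, and let $\mathbf Z_\varepsilon=\{k\in\mathbf Z^3 : Y_\varepsilon^k\subset\Omega\}$. Let $(r_\varepsilon)_{\varepsilon>0}$ be a family of positive radii with $r_\varepsilon/\varepsilon\to0$ as $\varepsilon\to0$. Put $$T_\varepsilon=\bigcup_{k\in\mathbf Z_\varepsilon}B(\varepsilon k,r_\varepsilon),\qquad dm_\varepsilon=\frac{3}{4\pi}\left(\frac{\varepsilon}{r_\varepsilon}\right)^3 1_{T_\varepsilon}(x)\,dx .$$ Then there is a constant $C>0$, depending only on $\Omega$ (in particular independent of $\varepsilon$, of the family $(r_\varepsilon)$ and of $\theta$), such that for every $\varepsilon>0$ and every real-valued $\theta\in H_0^1(\Omega)$, extended by zero outside $\Omega$, the function $|\theta|^2$ is $m_\varepsilon$-integrable and $$\int|\theta|^2\,dm_\varepsilon\le C\max\left(1,\frac{\varepsilon^3}{r_\varepsilon}\right)\int_\Omega|\nabla\theta|^2\,dx .$$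 -/

import Mathlib

open MeasureTheory Filter Topology
open scoped ContDiff ENNReal

namespace Suspension

/-- Three-dimensional Euclidean space, with its Euclidean norm and Lebesgue measure. -/
abbrev E3 : Type := EuclideanSpace ℝ (Fin 3)

/-- `φ` belongs to `𝒟(Ω)`: smooth, with compact support contained in `Ω`. -/
structure IsTestFunction (Ω : Set E3) (φ : E3 → ℝ) : Prop where
  contDiff : ContDiff ℝ ∞ φ
  hasCompactSupport : HasCompactSupport φ
  tsupport_subset : tsupport φ ⊆ Ω

/-- `G` is the weak (distributional) gradient of `u` on the open set `Ω`. -/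
structure HasWeakGradient (Ω : Set E3) (u : E3 → ℝ) (G : E3 → E3) : Prop where
  locallyIntegrableOn : LocallyIntegrableOn u Ω volume
  locallyIntegrableOn_grad : LocallyIntegrableOn G Ω volume
  integral_eq : ∀ φ : E3 → ℝ, IsTestFunction Ω φ →
    ∫ x in Ω, u x • gradient φ x = - ∫ x in Ω, φ x • G x

/-- `u` (of which only the restriction to `Ω` matters) belongs to `H¹₀(Ω)`, the closure of `𝒟(Ω)`
in `H¹(Ω)`: it lies in `L²(Ω)`, has a weak gradient in `L²(Ω)`, and is the limit
of a sequence of test functions in the norm of `H¹(Ω)`. -/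
def MemH10 (Ω : Set E3) (u : E3 → ℝ) : Prop :=
  MemLp u 2 (volume.restrict Ω) ∧
  ∃ G : E3 → E3, HasWeakGradient Ω u G ∧ MemLp G 2 (volume.restrict Ω) ∧
    ∃ φ : ℕ → E3 → ℝ, (∀ n, IsTestFunction Ω (φ n)) ∧
      Tendsto (fun n => eLpNorm (fun x => φ n x - u x) 2 (volume.restrict Ω)) atTop (𝓝 0) ∧
      Tendsto (fun n => eLpNorm (fun x => gradient (φ n) x - G x) 2 (volume.restrict Ω))
        atTop (𝓝 0)

/-- The point `ε k`, for `k ∈ ℤ³`. -/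
noncomputable def center (ε : ℝ) (k : Fin 3 → ℤ) : E3 :=
  WithLp.toLp 2 fun i => ε * (k i : ℝ)

/-- The open cell `ε k + ε Y`, where `Y = (-1/2, 1/2)³`. -/
def cell (ε : ℝ) (k : Fin 3 → ℤ) : Set E3 :=
  {x | ∀ i, |x i - ε * (k i : ℝ)| < ε / 2}

/-- The indices of the cells contained in `Ω`. -/
def cellIndices (Ω : Set E3) (ε : ℝ) : Set (Fin 3 → ℤ) :=
  {k | cell ε k ⊆ Ω}

/-- The union of the suspensions: the balls `B(ε k, ρ)` over all cells contained in `Ω`. -/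
def suspensions (Ω : Set E3) (ε ρ : ℝ) : Set E3 :=
  ⋃ k ∈ cellIndices Ω ε, Metric.ball (center ε k) ρ

/-- The measure `(3 / 4π) (ε / ρ)³ 1_T dx`, where `T` is the union of the suspensions of
radius `ρ`. -/
noncomputable def suspensionMeasure (Ω : Set E3) (ε ρ : ℝ) : Measure E3 :=
  ENNReal.ofReal (3 / (4 * Real.pi) * (ε / ρ) ^ 3) • volume.restrict (suspensions Ω ε ρ)

end Suspension

open Suspension

/-! For smooth `φ`, compare a small ball of radius `ρ` with the concentric ball of radius `R = ε /
2`. Along each ray, `φ x` is `φ (l • x)`, with `l = R / ρ`, minus a radial integral of the gradient.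
Squaring and integrating bounds the small-ball mass by `2 (ρ/R)³ ∫ φ² + 8 ρ² ∫ |∇φ|²` over the large
ball (`setLIntegral_ball_sq_le`). The large balls are disjoint, so these bounds add up. The factor
`(ε/ρ)³` turns the coefficients into `16` and `8 ε³/ρ`, and Poincaré absorbs `∫ φ²`. If `ρ > ε / 2`,
the density is bounded and Poincaré alone suffices. `MemH10.eLpNorm_le` extends the estimate to
`H¹₀` by density. -/

namespace Suspension

/-! ### Weighted Cauchy-Schwarz on `[1, l]` -/

/-- The Cauchy-Schwarz inequality for Lebesgue integrals. -/
theorem sq_lintegral_mul_le {α : Type*} [MeasurableSpace α] (μ : Measure α) {f g : α → ℝ≥0∞}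
    (hf : AEMeasurable f μ) (hg : AEMeasurable g μ) :
    (∫⁻ a, f a * g a ∂μ) ^ 2 ≤ (∫⁻ a, f a ^ 2 ∂μ) * ∫⁻ a, g a ^ 2 ∂μ := by
  have h := ENNReal.lintegral_mul_le_Lp_mul_Lq μ Real.HolderConjugate.two_two hf hg
  have h2 := pow_le_pow_left' h 2
  simp only [Pi.mul_apply, ENNReal.rpow_two, mul_pow] at h2
  rwa [← ENNReal.rpow_two, ← ENNReal.rpow_two, ← ENNReal.rpow_two, ← ENNReal.rpow_mul,
    ← ENNReal.rpow_mul, ENNReal.rpow_two, one_div, inv_mul_cancel₀ two_ne_zero,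
    ENNReal.rpow_one, ENNReal.rpow_one] at h2

theorem add_sq_le_two_mul (a b : ℝ≥0∞) : (a + b) ^ 2 ≤ 2 * a ^ 2 + 2 * b ^ 2 := by
  have h := ENNReal.rpow_add_le_mul_rpow_add_rpow a b (p := 2) one_le_two
  norm_num at h
  rwa [mul_add] at h

theorem lintegral_rpow_neg_three_halves_le (l : ℝ) :
    ∫⁻ s in Set.Icc 1 l, ENNReal.ofReal (s ^ (-3 / 2 : ℝ)) ≤ 2 := by
  calc ∫⁻ s in Set.Icc 1 l, ENNReal.ofReal (s ^ (-3 / 2 : ℝ))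
      ≤ ∫⁻ s in Set.Ici 1, ENNReal.ofReal (s ^ (-3 / 2 : ℝ)) :=
        lintegral_mono_set Set.Icc_subset_Ici_self
    _ = ∫⁻ s in Set.Ioi 1, ENNReal.ofReal (s ^ (-3 / 2 : ℝ)) := by
        rw [restrict_Ioi_eq_restrict_Ici]
    _ = ENNReal.ofReal (∫ s in Set.Ioi (1 : ℝ), s ^ (-3 / 2 : ℝ)) := by
        rw [ofReal_integral_eq_lintegral_ofReal
          (integrableOn_Ioi_rpow_of_lt (by norm_num) one_pos)]
        filter_upwards [ae_restrict_mem measurableSet_Ioi] with s hs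
        exact Real.rpow_nonneg (zero_le_one.trans (le_of_lt hs)) _
    _ ≤ 2 := by
        rw [integral_Ioi_rpow_of_lt (by norm_num) one_pos]
        norm_num

/-- Cauchy-Schwarz with weight `s ^ α`, `α = 3/2`. Any `1 < α < 2` would serve: `s ^ (-α)` must be
integrable at infinity, and so must `s ^ (α - 3)`, which appears after dilation in dimension three.
The constant is thus independent of `l`. -/
theorem sq_lintegral_Icc_le (l : ℝ) {g : ℝ → ℝ≥0∞} (hg : Measurable g) :
    (∫⁻ s in Set.Icc 1 l, g s) ^ 2 ≤
      2 * ∫⁻ s in Set.Icc 1 l, ENNReal.ofReal (s ^ (3 / 2 : ℝ)) * g s ^ 2 := by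
  have h := sq_lintegral_mul_le (volume.restrict (Set.Icc 1 l))
    (f := fun s => ENNReal.ofReal (s ^ (-3 / 4 : ℝ)))
    (g := fun s => ENNReal.ofReal (s ^ (3 / 4 : ℝ)) * g s)
    (by fun_prop) (by fun_prop)
  refine (le_of_eq ?_).trans (h.trans (mul_le_mul' ((le_of_eq ?_).trans
    (lintegral_rpow_neg_three_halves_le l)) (le_of_eq ?_)))
  · congr 1
    refine setLIntegral_congr_fun measurableSet_Icc fun s hs => ?_
    have hs0 : 0 < s := one_pos.trans_le hs.1
    rw [← mul_assoc, ← ENNReal.ofReal_mul (by positivity), ← Real.rpow_add hs0]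
    norm_num
  · refine setLIntegral_congr_fun measurableSet_Icc fun s hs => ?_
    have hs0 : 0 < s := one_pos.trans_le hs.1
    rw [← ENNReal.ofReal_pow (by positivity), ← Real.rpow_mul_natCast hs0.le]
    norm_num
  · refine setLIntegral_congr_fun measurableSet_Icc fun s hs => ?_
    have hs0 : 0 < s := one_pos.trans_le hs.1
    rw [mul_pow, ← ENNReal.ofReal_pow (by positivity), ← Real.rpow_mul_natCast hs0.le]
    norm_num

/-! ### Comparison of concentric balls -/

theorem setLIntegral_ball_comp_smul (f : E3 → ℝ≥0∞) {s : ℝ} (hs : 0 < s) (ρ : ℝ) :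
    ∫⁻ x in Metric.ball 0 ρ, f (s • x) =
      ENNReal.ofReal ((s ^ 3)⁻¹) * ∫⁻ x in Metric.ball 0 (s * ρ), f x := by
  have hpre : (fun x : E3 => s • x) ⁻¹' Metric.ball 0 (s * ρ) = Metric.ball 0 ρ := by
    ext x
    simp [norm_smul, abs_of_pos hs, hs]
  have hemb : MeasurableEmbedding (fun x : E3 => s • x) :=
    (Homeomorph.smulOfNeZero s hs.ne').measurableEmbedding
  have hmap := Measure.map_addHaar_smul (volume : Measure E3) hs.ne'
  rw [finrank_euclideanSpace_fin, abs_of_pos (by positivity)] at hmap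
  rw [← hpre, ← hemb.lintegral_map, ← hemb.restrict_map, hmap, Measure.restrict_smul,
    lintegral_smul_measure, smul_eq_mul]

theorem setLIntegral_ball_comp_add (f : E3 → ℝ≥0∞) (c : E3) (ρ : ℝ) :
    ∫⁻ x in Metric.ball 0 ρ, f (x + c) = ∫⁻ x in Metric.ball c ρ, f x := by
  rw [← (measurePreserving_add_right volume c).setLIntegral_comp_preimage_emb
    (measurableEmbedding_addRight c) f]
  congr 2
  ext x
  simp [dist_eq_norm]

/-- Fundamental theorem of calculus along the ray `s ↦ s • x`, whose velocity is `x`. -/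
theorem enorm_le_enorm_smul_add_lintegral {φ : E3 → ℝ} (hφ : ContDiff ℝ 1 φ) {l : ℝ}
    (hl : 1 ≤ l) (x : E3) :
    ‖φ x‖ₑ ≤ ‖φ (l • x)‖ₑ + ∫⁻ s in Set.Icc 1 l, ‖fderiv ℝ φ (s • x)‖ₑ * ‖x‖ₑ := by
  have hder : ∀ s : ℝ, HasDerivAt (fun s : ℝ => φ (s • x)) (fderiv ℝ φ (s • x) x) s := by
    intro s
    have h1 : HasDerivAt (fun s : ℝ => s • x) x s := by
      simpa using (hasDerivAt_id s).smul_const x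
    exact ((hφ.differentiable one_ne_zero) (s • x)).hasFDerivAt.comp_hasDerivAt s h1
  have h := enorm_sub_le_lintegral_deriv_of_contDiffOn_Icc (f := fun s : ℝ => φ (s • x))
    (a := 1) (b := l) (by fun_prop) hl
  have h2 : ∫⁻ s in Set.Icc 1 l, ‖deriv (fun s : ℝ => φ (s • x)) s‖ₑ ≤
      ∫⁻ s in Set.Icc 1 l, ‖fderiv ℝ φ (s • x)‖ₑ * ‖x‖ₑ := by
    refine lintegral_mono fun s => ?_
    rw [(hder s).deriv]
    exact ContinuousLinearMap.le_opENorm _ _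
  have h3 : ‖φ x‖ₑ ≤ ‖φ (l • x)‖ₑ + ‖φ (l • x) - φ x‖ₑ := by
    have := enorm_sub_le (a := φ (l • x)) (b := φ (l • x) - φ x)
    simpa using this
  simp only [one_smul] at h
  exact h3.trans (by gcongr; exact h.trans h2)

/-- On concentric balls, the mass of `φ ^ 2` on the small ball is controlled by its mean on the
large ball and by the Dirichlet energy. -/
theorem setLIntegral_ball_zero_sq_le {φ : E3 → ℝ} (hφ : ContDiff ℝ 1 φ) {ρ R : ℝ} (hρ : 0 < ρ)
    (hρR : ρ ≤ R) :
    ∫⁻ x in Metric.ball 0 ρ, ‖φ x‖ₑ ^ 2 ≤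
      2 * (ENNReal.ofReal ((ρ / R) ^ 3) * ∫⁻ x in Metric.ball 0 R, ‖φ x‖ₑ ^ 2) +
      2 * (4 * ENNReal.ofReal (ρ ^ 2) * ∫⁻ x in Metric.ball 0 R, ‖fderiv ℝ φ x‖ₑ ^ 2) := by
  have hR : 0 < R := hρ.trans_le hρR
  set l := R / ρ with hl
  have hl1 : 1 ≤ l := (one_le_div hρ).2 hρR
  have hl0 : 0 < l := one_pos.trans_le hl1
  have hlρ : l * ρ = R := div_mul_cancel₀ R hρ.ne'
  have hc : Continuous (fderiv ℝ φ) := hφ.continuous_fderiv one_ne_zero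
  have hcφ : Continuous φ := hφ.continuous
  set D := ∫⁻ x in Metric.ball (0 : E3) R, ‖fderiv ℝ φ x‖ₑ ^ 2
  have hmeas : Measurable fun p : E3 × ℝ =>
      ENNReal.ofReal (p.2 ^ (3 / 2 : ℝ)) * (‖fderiv ℝ φ (p.2 • p.1)‖ₑ * ‖p.1‖ₑ) ^ 2 := by
    have h1 : Measurable fun p : E3 × ℝ => ‖fderiv ℝ φ (p.2 • p.1)‖ₑ :=
      (by fun_prop : Continuous fun p : E3 × ℝ => fderiv ℝ φ (p.2 • p.1)).enorm.measurable
    have h2 : Measurable fun p : E3 × ℝ => ‖p.1‖ₑ := continuous_fst.enorm.measurable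
    fun_prop
  have hrad : ∫⁻ x in Metric.ball (0 : E3) ρ,
      (∫⁻ s in Set.Icc 1 l, ‖fderiv ℝ φ (s • x)‖ₑ * ‖x‖ₑ) ^ 2 ≤
      4 * ENNReal.ofReal (ρ ^ 2) * D := by
    calc ∫⁻ x in Metric.ball (0 : E3) ρ,
        (∫⁻ s in Set.Icc 1 l, ‖fderiv ℝ φ (s • x)‖ₑ * ‖x‖ₑ) ^ 2
        ≤ ∫⁻ x in Metric.ball (0 : E3) ρ, 2 * ∫⁻ s in Set.Icc 1 l,
            ENNReal.ofReal (s ^ (3 / 2 : ℝ)) * (‖fderiv ℝ φ (s • x)‖ₑ * ‖x‖ₑ) ^ 2 := by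
          refine lintegral_mono fun x => sq_lintegral_Icc_le l ?_
          exact (by fun_prop : Continuous fun s : ℝ =>
            fderiv ℝ φ (s • x)).enorm.measurable.mul_const _
      _ = 2 * ∫⁻ s in Set.Icc 1 l, ∫⁻ x in Metric.ball (0 : E3) ρ,
            ENNReal.ofReal (s ^ (3 / 2 : ℝ)) * (‖fderiv ℝ φ (s • x)‖ₑ * ‖x‖ₑ) ^ 2 := by
          -- Tonelli: with `s` fixed, the dilation `x ↦ s • x` can be undone in the inner integral.
          rw [lintegral_const_mul' _ _ (by simp), lintegral_lintegral_swap hmeas.aemeasurable]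
      _ ≤ 2 * ∫⁻ s in Set.Icc 1 l,
            ENNReal.ofReal (ρ ^ 2) * D * ENNReal.ofReal (s ^ (-3 / 2 : ℝ)) := by
          gcongr 2 * ?_
          refine setLIntegral_mono_ae' measurableSet_Icc (ae_of_all _ fun s hs => ?_)
          have hs0 : 0 < s := one_pos.trans_le hs.1
          calc ∫⁻ x in Metric.ball (0 : E3) ρ,
                ENNReal.ofReal (s ^ (3 / 2 : ℝ)) * (‖fderiv ℝ φ (s • x)‖ₑ * ‖x‖ₑ) ^ 2
              ≤ ∫⁻ x in Metric.ball (0 : E3) ρ, ENNReal.ofReal (s ^ (3 / 2 : ℝ)) *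
                  ENNReal.ofReal (ρ ^ 2) * ‖fderiv ℝ φ (s • x)‖ₑ ^ 2 := by
                refine setLIntegral_mono_ae' measurableSet_ball (ae_of_all _ fun x hx => ?_)
                have hx' : ‖x‖ₑ ≤ ENNReal.ofReal ρ := by
                  rw [← ofReal_norm]
                  exact ENNReal.ofReal_le_ofReal (mem_ball_zero_iff.1 hx).le
                rw [mul_pow, mul_assoc, mul_comm (‖fderiv ℝ φ (s • x)‖ₑ ^ 2),
                  ENNReal.ofReal_pow hρ.le]
                gcongr
            _ = ENNReal.ofReal (s ^ (3 / 2 : ℝ)) * ENNReal.ofReal (ρ ^ 2) *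
                (ENNReal.ofReal ((s ^ 3)⁻¹) *
                  ∫⁻ x in Metric.ball 0 (s * ρ), ‖fderiv ℝ φ x‖ₑ ^ 2) := by
                rw [lintegral_const_mul' _ _ (by finiteness),
                  setLIntegral_ball_comp_smul (fun x => ‖fderiv ℝ φ x‖ₑ ^ 2) hs0]
            -- Since `s ≤ l`, the dilated ball stays inside the ball of radius `l * ρ = R`.
            _ ≤ ENNReal.ofReal (s ^ (3 / 2 : ℝ)) * ENNReal.ofReal (ρ ^ 2) *
                (ENNReal.ofReal ((s ^ 3)⁻¹) * D) := by
                gcongr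
                refine lintegral_mono_set (Metric.ball_subset_ball ?_)
                rw [← hlρ]
                gcongr
                exact hs.2
            _ = ENNReal.ofReal (ρ ^ 2) * D * ENNReal.ofReal (s ^ (-3 / 2 : ℝ)) := by
                have : s ^ (-3 / 2 : ℝ) = s ^ (3 / 2 : ℝ) * (s ^ 3)⁻¹ := by
                  rw [← Real.rpow_natCast, ← Real.rpow_neg hs0.le, ← Real.rpow_add hs0]
                  norm_num
                rw [this, ENNReal.ofReal_mul (by positivity)]
                ring
      _ ≤ 2 * (ENNReal.ofReal (ρ ^ 2) * D * 2) := by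
          rw [lintegral_const_mul _ (by fun_prop)]
          gcongr
          exact lintegral_rpow_neg_three_halves_le l
      _ = 4 * ENNReal.ofReal (ρ ^ 2) * D := by ring
  have hdil : ∫⁻ x in Metric.ball (0 : E3) ρ, ‖φ (l • x)‖ₑ ^ 2 =
      ENNReal.ofReal ((ρ / R) ^ 3) * ∫⁻ x in Metric.ball 0 R, ‖φ x‖ₑ ^ 2 := by
    rw [setLIntegral_ball_comp_smul (fun x => ‖φ x‖ₑ ^ 2) hl0, hlρ, hl, ← inv_pow, inv_div]
  have hmφ : Measurable fun x : E3 => 2 * ‖φ (l • x)‖ₑ ^ 2 := by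
    have : Measurable fun x : E3 => ‖φ (l • x)‖ₑ :=
      (by fun_prop : Continuous fun x : E3 => φ (l • x)).enorm.measurable
    fun_prop
  calc ∫⁻ x in Metric.ball 0 ρ, ‖φ x‖ₑ ^ 2
      ≤ ∫⁻ x in Metric.ball 0 ρ, (2 * ‖φ (l • x)‖ₑ ^ 2 +
          2 * (∫⁻ s in Set.Icc 1 l, ‖fderiv ℝ φ (s • x)‖ₑ * ‖x‖ₑ) ^ 2) :=
        lintegral_mono fun x => (pow_le_pow_left'
          (enorm_le_enorm_smul_add_lintegral hφ hl1 x) 2).trans (add_sq_le_two_mul _ _)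
    _ ≤ _ := by
        rw [lintegral_add_left hmφ, lintegral_const_mul' _ _ (by simp),
          lintegral_const_mul' _ _ (by simp), hdil]
        gcongr

theorem setLIntegral_ball_sq_le {φ : E3 → ℝ} (hφ : ContDiff ℝ 1 φ) (c : E3) {ρ R : ℝ}
    (hρ : 0 < ρ) (hρR : ρ ≤ R) :
    ∫⁻ x in Metric.ball c ρ, ‖φ x‖ₑ ^ 2 ≤
      2 * (ENNReal.ofReal ((ρ / R) ^ 3) * ∫⁻ x in Metric.ball c R, ‖φ x‖ₑ ^ 2) +
      2 * (4 * ENNReal.ofReal (ρ ^ 2) * ∫⁻ x in Metric.ball c R, ‖fderiv ℝ φ x‖ₑ ^ 2) := by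
  have h := setLIntegral_ball_zero_sq_le (φ := fun x => φ (x + c)) (by fun_prop) hρ hρR
  simp only [fderiv_comp_add_right] at h
  rwa [setLIntegral_ball_comp_add (fun x => ‖φ x‖ₑ ^ 2),
    setLIntegral_ball_comp_add (fun x => ‖φ x‖ₑ ^ 2),
    setLIntegral_ball_comp_add (fun x => ‖fderiv ℝ φ x‖ₑ ^ 2)] at h

/-! ### Summation over the lattice -/

theorem pairwise_disjoint_ball_center {ε : ℝ} (hε : 0 < ε) :
    Pairwise (Function.onFun Disjoint fun k => Metric.ball (center ε k) (ε / 2)) := by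
  intro k j hkj
  refine Metric.ball_disjoint_ball ?_
  obtain ⟨i, hi⟩ := Function.ne_iff.1 hkj
  have h1 : (1 : ℝ) ≤ |(k i : ℝ) - j i| := by
    exact_mod_cast Int.one_le_abs (sub_ne_zero.2 hi)
  have h2 : dist (center ε k i) (center ε j i) ≤ dist (center ε k) (center ε j) := by
    simpa [dist_eq_norm] using PiLp.norm_apply_le (center ε k - center ε j) i
  have h3 : dist (center ε k i) (center ε j i) = ε * |(k i : ℝ) - j i| := by
    rw [Real.dist_eq, center, center, ← abs_of_pos hε, ← abs_mul, abs_of_pos hε]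
    simp [mul_sub]
  nlinarith

/-- The balls of radius `ε / 2` are disjoint, so the local bounds sum to integrals over the whole
space. All lattice points may be kept, which only enlarges the left side. -/
theorem setLIntegral_suspensions_sq_le (Ω : Set E3) {φ : E3 → ℝ} (hφ : ContDiff ℝ 1 φ)
    {ε ρ : ℝ} (hρ : 0 < ρ) (hρε : ρ ≤ ε / 2) :
    ∫⁻ x in suspensions Ω ε ρ, ‖φ x‖ₑ ^ 2 ≤
      2 * (ENNReal.ofReal ((ρ / (ε / 2)) ^ 3) * ∫⁻ x, ‖φ x‖ₑ ^ 2) +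
      2 * (4 * ENNReal.ofReal (ρ ^ 2) * ∫⁻ x, ‖fderiv ℝ φ x‖ₑ ^ 2) := by
  have hε : 0 < ε := by linarith
  have hsum : ∀ f : E3 → ℝ≥0∞,
      ∑' k, ∫⁻ x in Metric.ball (center ε k) (ε / 2), f x ≤ ∫⁻ x, f x := by
    intro f
    rw [← lintegral_iUnion (fun k => measurableSet_ball) (pairwise_disjoint_ball_center hε)]
    exact setLIntegral_le_lintegral _ _
  calc ∫⁻ x in suspensions Ω ε ρ, ‖φ x‖ₑ ^ 2
      ≤ ∫⁻ x in ⋃ k, Metric.ball (center ε k) ρ, ‖φ x‖ₑ ^ 2 :=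
        lintegral_mono_set (Set.iUnion₂_subset_iUnion _ _)
    _ ≤ ∑' k, ∫⁻ x in Metric.ball (center ε k) ρ, ‖φ x‖ₑ ^ 2 := lintegral_iUnion_le _ _
    _ ≤ ∑' k, (2 * (ENNReal.ofReal ((ρ / (ε / 2)) ^ 3) *
            ∫⁻ x in Metric.ball (center ε k) (ε / 2), ‖φ x‖ₑ ^ 2) +
          2 * (4 * ENNReal.ofReal (ρ ^ 2) *
            ∫⁻ x in Metric.ball (center ε k) (ε / 2), ‖fderiv ℝ φ x‖ₑ ^ 2)) :=
        ENNReal.tsum_le_tsum fun k => setLIntegral_ball_sq_le hφ _ hρ hρε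
    _ ≤ _ := by
        rw [ENNReal.tsum_add]
        simp only [ENNReal.tsum_mul_left]
        gcongr <;> exact hsum _

/-! ### Poincaré inequality and the rescaled estimate -/

/-- The Poincaré inequality for functions supported in a bounded set. -/
theorem exists_lintegral_sq_le_lintegral_fderiv_sq {Ω : Set E3} (hΩ : Bornology.IsBounded Ω) :
    ∃ P : ℝ, 0 ≤ P ∧ ∀ φ : E3 → ℝ, ContDiff ℝ 1 φ → φ.support ⊆ Ω →
      ∫⁻ x, ‖φ x‖ₑ ^ 2 ≤ ENNReal.ofReal P * ∫⁻ x, ‖fderiv ℝ φ x‖ₑ ^ 2 := by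
  refine ⟨(eLpNormLESNormFDerivOfLeConst ℝ (volume : Measure E3) Ω 2 2 : ℝ) ^ 2, by positivity,
    fun φ hφ hs => ?_⟩
  have h := eLpNorm_le_eLpNorm_fderiv volume hφ hs (p := 2) one_le_two
    -- The Sobolev exponent must lie below the dimension: `2 < 3`.
    (by rw [finrank_euclideanSpace_fin]; norm_num) hΩ
  have h2 := pow_le_pow_left' h 2
  have e : ∀ {F : Type} [NormedAddCommGroup F] (f : E3 → F),
      eLpNorm f (2 : NNReal) volume ^ 2 = ∫⁻ x, ‖f x‖ₑ ^ 2 := by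
    intro F _ f
    simpa using eLpNorm_nnreal_pow_eq_lintegral (f := f) (μ := volume) (p := 2) two_ne_zero
  rw [mul_pow, e, e] at h2
  rwa [ENNReal.ofReal_pow (by positivity), ENNReal.ofReal_coe_nnreal]

theorem ofReal_mul_setLIntegral_suspensions_sq_le (Ω : Set E3) {φ : E3 → ℝ}
    (hφ : ContDiff ℝ 1 φ) {P : ℝ} (hP : 0 ≤ P)
    (hPφ : ∫⁻ x, ‖φ x‖ₑ ^ 2 ≤ ENNReal.ofReal P * ∫⁻ x, ‖fderiv ℝ φ x‖ₑ ^ 2)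
    {ε ρ : ℝ} (hε : 0 < ε) (hρ : 0 < ρ) :
    ENNReal.ofReal ((ε / ρ) ^ 3) * ∫⁻ x in suspensions Ω ε ρ, ‖φ x‖ₑ ^ 2 ≤
      ENNReal.ofReal ((16 * P + 8) * max 1 (ε ^ 3 / ρ)) * ∫⁻ x, ‖fderiv ℝ φ x‖ₑ ^ 2 := by
  set D := ∫⁻ x, ‖fderiv ℝ φ x‖ₑ ^ 2
  have hm1 : 1 ≤ max 1 (ε ^ 3 / ρ) := le_max_left _ _
  have hm2 : ε ^ 3 / ρ ≤ max 1 (ε ^ 3 / ρ) := le_max_right _ _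
  rcases le_or_gt ρ (ε / 2) with h | h
  · calc ENNReal.ofReal ((ε / ρ) ^ 3) * ∫⁻ x in suspensions Ω ε ρ, ‖φ x‖ₑ ^ 2
        ≤ ENNReal.ofReal ((ε / ρ) ^ 3) *
          (2 * (ENNReal.ofReal ((ρ / (ε / 2)) ^ 3) * (ENNReal.ofReal P * D)) +
            2 * (4 * ENNReal.ofReal (ρ ^ 2) * D)) := by
          gcongr
          refine (setLIntegral_suspensions_sq_le Ω hφ hρ h).trans ?_
          gcongr
      -- `(ε/ρ)³ * 2 * (2ρ/ε)³ = 16` and `(ε/ρ)³ * 8 * ρ² = 8 * (ε³/ρ)`.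
      _ = ENNReal.ofReal (16 * P + 8 * (ε ^ 3 / ρ)) * D := by
          have h2 : (2 : ℝ≥0∞) = ENNReal.ofReal 2 := by simp
          have h4 : (4 : ℝ≥0∞) = ENNReal.ofReal 4 := by simp
          rw [h2, h4, ← mul_assoc (ENNReal.ofReal _) (ENNReal.ofReal P) D,
            ← ENNReal.ofReal_mul (by positivity), ← ENNReal.ofReal_mul (by positivity),
            ← mul_assoc, ← mul_assoc, ← add_mul, ← mul_assoc,
            ← ENNReal.ofReal_mul (by positivity), ← ENNReal.ofReal_mul (by positivity),
            ← ENNReal.ofReal_add (by positivity) (by positivity),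
            ← ENNReal.ofReal_mul (by positivity)]
          congr 2
          field_simp
          ring
      _ ≤ _ := by
          gcongr
          nlinarith
  -- Large radii, where balls may overlap: here `ε / ρ < 2`, so no local estimate is needed.
  · calc ENNReal.ofReal ((ε / ρ) ^ 3) * ∫⁻ x in suspensions Ω ε ρ, ‖φ x‖ₑ ^ 2
        ≤ ENNReal.ofReal (2 ^ 3) * (ENNReal.ofReal P * D) := by
          gcongr
          · rw [div_le_iff₀ hρ]
            linarith
          · exact (setLIntegral_le_lintegral _ _).trans hPφ
      _ = ENNReal.ofReal (2 ^ 3 * P) * D := by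
          rw [ENNReal.ofReal_mul (by positivity), mul_assoc]
      _ ≤ _ := by
          refine mul_le_mul_left (ENNReal.ofReal_le_ofReal ?_) _
          nlinarith

/-! ### From test functions to `H¹₀` -/

theorem eLpNorm_two_sq {F : Type*} [NormedAddCommGroup F] (f : E3 → F) (μ : Measure E3) :
    eLpNorm f 2 μ ^ 2 = ∫⁻ x, ‖f x‖ₑ ^ 2 ∂μ := by
  simpa using eLpNorm_nnreal_pow_eq_lintegral (f := f) (μ := μ) (p := 2) two_ne_zero

theorem enorm_gradient (φ : E3 → ℝ) (x : E3) : ‖gradient φ x‖ₑ = ‖fderiv ℝ φ x‖ₑ := by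
  rw [gradient, LinearIsometryEquiv.enorm_map]

theorem IsTestFunction.lintegral_fderiv_sq_eq {Ω : Set E3} {φ : E3 → ℝ}
    (hφ : IsTestFunction Ω φ) :
    ∫⁻ x, ‖fderiv ℝ φ x‖ₑ ^ 2 = eLpNorm (gradient φ) 2 (volume.restrict Ω) ^ 2 := by
  rw [eLpNorm_two_sq]
  simp only [enorm_gradient]
  refine (setLIntegral_eq_of_support_subset fun x hx => hφ.tsupport_subset ?_).symm
  refine support_fderiv_subset ℝ fun h => hx ?_
  refine (pow_eq_zero_iff two_ne_zero).2 ?_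
  rw [← ofReal_norm, norm_eq_zero.2 h, ENNReal.ofReal_zero]

/-- Weak gradients are unique up to null sets. -/
theorem HasWeakGradient.ae_eq {Ω : Set E3} (hΩ : IsOpen Ω) {u : E3 → ℝ} {G H : E3 → E3}
    (hG : HasWeakGradient Ω u G) (hH : HasWeakGradient Ω u H) :
    G =ᵐ[volume.restrict Ω] H := by
  have hint : ∀ {F : E3 → E3}, LocallyIntegrableOn F Ω volume → ∀ {φ : E3 → ℝ},
      IsTestFunction Ω φ → Integrable fun x => φ x • F x := by
    intro F hF φ hφ
    have h1 : IntegrableOn (fun x => φ x • F x) (tsupport φ) :=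
      (hF.integrableOn_compact_subset hφ.tsupport_subset hφ.hasCompactSupport).continuousOn_smul
        hφ.contDiff.continuous.continuousOn hφ.hasCompactSupport
    refine (integrableOn_iff_integrable_of_support_subset fun x hx => ?_).1 h1
    refine subset_tsupport φ fun h => hx ?_
    simp [h]
  rw [Filter.EventuallyEq, ae_restrict_iff' hΩ.measurableSet]
  -- Fundamental lemma of the calculus of variations, applied to `G - H`.
  have := hΩ.ae_eq_zero_of_integral_contDiff_smul_eq_zero (f := fun x => G x - H x)
    (hG.locallyIntegrableOn_grad.sub hH.locallyIntegrableOn_grad) fun φ h1 h2 h3 => by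
      have hφ : IsTestFunction Ω φ := ⟨h1, h2, h3⟩
      have hr : ∀ F : E3 → E3, ∫ x in Ω, φ x • F x = ∫ x, φ x • F x := fun F =>
        setIntegral_eq_integral_of_forall_compl_eq_zero fun x hx => by
          rw [image_eq_zero_of_notMem_tsupport fun h => hx (h3 h), zero_smul]
      have h := neg_injective ((hG.integral_eq φ hφ).symm.trans (hH.integral_eq φ hφ))
      rw [hr, hr] at h
      simp only [smul_sub]
      rw [integral_sub (hint hG.locallyIntegrableOn_grad hφ)
        (hint hH.locallyIntegrableOn_grad hφ), h, sub_self]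
  filter_upwards [this] with x hx hxΩ
  exact sub_eq_zero.1 (hx hxΩ)

/-- A gradient estimate for test functions extends to `H¹₀` by density. -/
theorem MemH10.eLpNorm_le {Ω : Set E3} (hΩ : IsOpen Ω) {θ : E3 → ℝ} {gradθ : E3 → E3}
    (hθ : MemH10 Ω θ) (hgrad : HasWeakGradient Ω θ gradθ) {μ : Measure E3} {a K : ℝ≥0∞}
    (ha : a ≠ ⊤) (hK : K ≠ ⊤) (hμ : μ ≤ a • volume.restrict Ω)
    (hφ : ∀ φ, IsTestFunction Ω φ →
      eLpNorm φ 2 μ ≤ K * eLpNorm (gradient φ) 2 (volume.restrict Ω)) :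
    eLpNorm θ 2 μ ≤ K * eLpNorm gradθ 2 (volume.restrict Ω) := by
  obtain ⟨hθ2, G, hG, hG2, φ, htest, hlim, hlimG⟩ := hθ
  rw [eLpNorm_congr_ae (hgrad.ae_eq hΩ hG)]
  have hac : μ ≪ volume.restrict Ω :=
    (Measure.absolutelyContinuous_of_le hμ).trans Measure.smul_absolutelyContinuous
  have hmφ : ∀ n (ν : Measure E3), AEStronglyMeasurable (φ n) ν := fun n ν =>
    (htest n).contDiff.continuous.aestronglyMeasurable
  have hmg : ∀ n (ν : Measure E3), AEStronglyMeasurable (gradient (φ n)) ν := fun n ν =>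
    ((InnerProductSpace.toDual ℝ E3).symm.continuous.comp
      ((htest n).contDiff.continuous_fderiv (by simp))).aestronglyMeasurable
  have key : ∀ n, eLpNorm θ 2 μ ≤
      a ^ (1 / (2 : ℝ≥0∞)).toReal * eLpNorm (fun x => φ n x - θ x) 2 (volume.restrict Ω) +
      K * (eLpNorm (fun x => gradient (φ n) x - G x) 2 (volume.restrict Ω) +
        eLpNorm G 2 (volume.restrict Ω)) := by
    intro n
    have h1 : eLpNorm θ 2 μ ≤ eLpNorm (fun x => φ n x - θ x) 2 μ + eLpNorm (φ n) 2 μ := by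
      have := eLpNorm_sub_le (hmφ n μ) ((hmφ n μ).sub (hθ2.1.mono_ac hac)) one_le_two
      rw [sub_sub_cancel, add_comm] at this
      exact this
    have h2 : eLpNorm (gradient (φ n)) 2 (volume.restrict Ω) ≤
        eLpNorm (fun x => gradient (φ n) x - G x) 2 (volume.restrict Ω) +
          eLpNorm G 2 (volume.restrict Ω) := by
      have := eLpNorm_add_le ((hmg n (volume.restrict Ω)).sub hG2.1) hG2.1 one_le_two
      rw [sub_add_cancel] at this
      exact this
    have h3 : eLpNorm (fun x => φ n x - θ x) 2 μ ≤
        a ^ (1 / (2 : ℝ≥0∞)).toReal *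
          eLpNorm (fun x => φ n x - θ x) 2 (volume.restrict Ω) := by
      refine (eLpNorm_mono_measure _ hμ).trans_eq ?_
      rw [eLpNorm_smul_measure_of_ne_top ENNReal.ofNat_ne_top, smul_eq_mul]
    refine h1.trans (add_le_add h3 ((hφ _ (htest n)).trans ?_))
    gcongr
  have ha' : a ^ (1 / (2 : ℝ≥0∞)).toReal ≠ ⊤ := 
    ENNReal.rpow_ne_top_of_nonneg ENNReal.toReal_nonneg ha
  -- The factor `a` multiplies only a term tending to zero, so its finiteness is enough and it
  -- leaves no trace in the final constant.
  have hT := (ENNReal.Tendsto.const_mul hlim (Or.inr ha')).add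
    (ENNReal.Tendsto.const_mul
      (hlimG.add (tendsto_const_nhds (x := eLpNorm G 2 (volume.restrict Ω)))) (Or.inr hK))
  simp only [mul_zero, zero_add] at hT
  exact ge_of_tendsto' hT key

end Suspension

/-! ### The estimate for the suspension measure -/

theorem proposition2p4 (Ω : Set E3) (hΩ : IsOpen Ω) (hΩb : Bornology.IsBounded Ω) :
    ∃ C : ℝ, 0 < C ∧
      ∀ r : ℝ → ℝ, (∀ ε : ℝ, 0 < ε → 0 < r ε) →
        Tendsto (fun ε => r ε / ε) (𝓝[>] 0) (𝓝 0) →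
        ∀ ε : ℝ, 0 < ε →
          ∀ (θ : E3 → ℝ) (gradθ : E3 → E3), MemH10 Ω θ → HasWeakGradient Ω θ gradθ →
            IntegrableOn (fun x => |θ x| ^ 2) Ω (suspensionMeasure Ω ε (r ε)) ∧
            ∫ x in Ω, |θ x| ^ 2 ∂(suspensionMeasure Ω ε (r ε)) ≤
              C * max 1 (ε ^ 3 / r ε) * ∫ x in Ω, ‖gradθ x‖ ^ 2 := by
  obtain ⟨P, hP, hPoincare⟩ := exists_lintegral_sq_le_lintegral_fderiv_sq hΩb
  refine ⟨16 * P + 8, by positivity, fun r hr _ ε hε θ gradθ hθ hgrad => ?_⟩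
  have hρ := hr ε hε
  set ρ := r ε
  set K := (16 * P + 8) * max 1 (ε ^ 3 / ρ)
  have hK : 0 ≤ K := by positivity
  set a := ENNReal.ofReal (3 / (4 * Real.pi) * (ε / ρ) ^ 3)
  set μ := (suspensionMeasure Ω ε ρ).restrict Ω with hμ
  have hμ_eq : μ = a • (volume.restrict (suspensions Ω ε ρ)).restrict Ω := by
    rw [hμ, suspensionMeasure, Measure.restrict_smul]
  have hμ_le : μ ≤ a • volume.restrict Ω := by
    rw [hμ_eq]
    gcongr
    exact Measure.restrict_le_self
  -- The prefactor `3 / (4π)` is below `1`, so it can be dropped.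
  have ha_le : a ≤ ENNReal.ofReal ((ε / ρ) ^ 3) := by
    refine ENNReal.ofReal_le_ofReal (mul_le_of_le_one_left (by positivity) ?_)
    rw [div_le_one (by positivity)]
    linarith [Real.pi_gt_three]
  have htest : ∀ φ, IsTestFunction Ω φ →
      eLpNorm φ 2 μ ≤ ENNReal.ofReal √K * eLpNorm (gradient φ) 2 (volume.restrict Ω) := by
    intro φ hφ
    have hφ1 : ContDiff ℝ 1 φ := hφ.contDiff.of_le (by simp)
    rw [← ENNReal.pow_le_pow_left_iff two_ne_zero, mul_pow, ← ENNReal.ofReal_pow (by positivity),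
      Real.sq_sqrt hK, ← hφ.lintegral_fderiv_sq_eq, eLpNorm_two_sq]
    refine le_trans ?_ (ofReal_mul_setLIntegral_suspensions_sq_le Ω hφ1 hP
      (hPoincare φ hφ1 ((subset_tsupport φ).trans hφ.tsupport_subset)) hε hρ)
    rw [hμ_eq, lintegral_smul_measure, smul_eq_mul]
    exact mul_le_mul' ha_le (lintegral_mono' Measure.restrict_le_self le_rfl)
  have hmem : MemLp θ 2 μ := (hθ.1.smul_measure ENNReal.ofReal_ne_top).mono_measure hμ_le
  -- Square integrability is known for the gradient supplied by `MemH10`; uniqueness transfers it to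
  -- `gradθ`.
  have hgrad2 : MemLp gradθ 2 (volume.restrict Ω) := by
    obtain ⟨-, G, hG, hG2, -⟩ := hθ
    exact hG2.ae_eq (hG.ae_eq hΩ hgrad)
  have hbound := pow_le_pow_left' (hθ.eLpNorm_le hΩ hgrad ENNReal.ofReal_ne_top
    ENNReal.ofReal_ne_top hμ_le htest) 2
  rw [mul_pow, ← ENNReal.ofReal_pow (by positivity), Real.sq_sqrt hK, eLpNorm_two_sq,
    eLpNorm_two_sq] at hbound
  have hintθ : Integrable (fun x => |θ x| ^ 2) μ := hmem.integrable_norm_pow two_ne_zero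
  have hintG : Integrable (fun x => ‖gradθ x‖ ^ 2) (volume.restrict Ω) :=
    hgrad2.integrable_norm_pow two_ne_zero
  refine ⟨hintθ, ?_⟩
  rw [← ENNReal.ofReal_le_ofReal_iff (by positivity), ENNReal.ofReal_mul hK,
    ofReal_integral_eq_lintegral_ofReal hintθ (ae_of_all _ fun x => by positivity),
    ofReal_integral_eq_lintegral_ofReal hintG (ae_of_all _ fun x => by positivity)]
  simpa only [← Real.norm_eq_abs, ENNReal.ofReal_pow (norm_nonneg _), ofReal_norm] using hbound
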